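/- Let $a,\beta,\gamma>0$ with $\beta\gamma>1$. Consider the Markovian (marked) Hawkes intensity process $$\lambda_t = a + (\lambda_0-a)e^{-\beta t} + \sum_{i=1}^{N_t} Y_i e^{-\beta (t-T_i)},\qquad t\ge 0,$$ with values in $[a,\infty)$, where $N$ is the counting process with arrival times $0<T_1<T_2<\cdots$ and stochastic intensity $\lambda$: given $\lambda_0$ and $T_1,Y_1,\dots,T_n,Y_n$ (with $T_0=0$), $$\mathbb P[T_{n+1}>t\mid \lambda_0,T_1,Y_1,\dots,T_n,Y_n]=\exp\Big(-\int_{T_n}^t \Big(a+(\lambda_0-a)e^{-\beta s}+\sum_{i=1}^n Y_i e^{-\beta(s-T_i)}\Big)\,ds\Big),\qquad t\ge T_n,$$ and each shock $Y_{n+1}$ is exponentially distributed with rate $\gamma$ and independent of $\lambda_0,T_1,Y_1,\dots,T_n,Y_n,T_{n+1}$. Call a Borel probability measure $\nu$ on $[a,\infty)$ a stationary distribution if $\int \mathbb P_x[\lambda_t\in B]\,\nu(dx)=\nu(B)$ for all $t\ge 0$ and all Borel sets $B$, where $\mathbb P_x$ is the law of the process started from $\lambda_0=x$. Then the stationary distribution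 $\nu$ exists, is unique, and is the shifted Gamma law $$\nu \sim a+\mathrm{Gamma}\Big(\frac a\beta,\ \frac{\beta\gamma-1}{\beta}\Big)$$ with shape $a/\beta$ and rate $(\beta\gamma-1)/\beta$; that is, $\nu$ has density proportional to $(x-a)^{a/\beta-1}e^{-\frac{\beta\gamma-1}{\beta}(x-a)}$ on $(a,\infty)$. -/

import Mathlib

open MeasureTheory ProbabilityTheory

noncomputable section

namespace MarkovHawkes

/-- Successive construction of the marked Hawkes process with baseline `a`, exponential decay `β`,
initial intensity `x`, shocks `y 0, y 1, …` and clock thresholds `e 0, e 1, …`.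

The value at `n` is the pair of the `n`-th arrival time `T` (with `T = 0` for `n = 0`) and the
intensity curve `H` that the process follows from `T` on as long as no further event occurs.
The next event happens at the first time `t ≥ T` at which the intensity accumulated since `T` has
reached the threshold `e n`.  With `e n` an independent standard exponential variable, the waiting
time has conditional survival function `exp (- ∫ s in T..t, H s)`, i.e. conditional hazard rate `H`.
At the event the intensity increases by `y n`, and this increase decays exponentially. -/
def stage (a β x : ℝ) (e y : ℕ → ℝ) : ℕ → ℝ × (ℝ → ℝ)
  | 0 => (0, fun t => a + (x - a) * Real.exp (-β * t))
  | n + 1 =>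
    let T := (stage a β x e y n).1
    let H := (stage a β x e y n).2
    let T' := sInf {t : ℝ | T ≤ t ∧ e n ≤ ∫ s in T..t, H s}
    (T', fun t => H t + y n * Real.exp (-β * (t - T')))

/-- The time of the `(i + 1)`-st event, `i = 0, 1, 2, …`. -/
def arrivalTime (a β x : ℝ) (e y : ℕ → ℝ) (i : ℕ) : ℝ := (stage a β x e y (i + 1)).1

/-- The curve followed after `n` events is
`a + (x - a) exp (-β t) + ∑ over the first n events of (shock) * exp (-β (t - event time))`. -/
theorem stage_snd (a β x : ℝ) (e y : ℕ → ℝ) (n : ℕ) (t : ℝ) :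
    (stage a β x e y n).2 t = a + (x - a) * Real.exp (-β * t) +
      ∑ i ∈ Finset.range n, y i * Real.exp (-β * (t - arrivalTime a β x e y i)) := by
  induction n with
  | zero => simp [stage]
  | succ n ih =>
    rw [Finset.sum_range_succ, ← add_assoc, ← ih]
    rfl

/-- The number `N_t` of events in `(0, t]`. -/
def count (a β x : ℝ) (e y : ℕ → ℝ) (t : ℝ) : ℕ :=
  Set.ncard {i : ℕ | arrivalTime a β x e y i ≤ t}

/-- The intensity process
`λ_t = a + (x - a) exp (-β t) + ∑_{i ≤ N_t} Y_i exp (-β (t - T_i))` started from `λ_0 = x`. -/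
def intensity (a β x : ℝ) (e y : ℕ → ℝ) (t : ℝ) : ℝ :=
  a + (x - a) * Real.exp (-β * t) +
    ∑ i ∈ Finset.range (count a β x e y t),
      y i * Real.exp (-β * (t - arrivalTime a β x e y i))

/-- The law of the driving sequence: independent pairs of a standard exponential threshold and an
independent shock with the exponential distribution of rate `γ`. -/
def drivingLaw (γ : ℝ) : Measure (ℕ → ℝ × ℝ) :=
  Measure.infinitePi fun _ => (expMeasure 1).prod (expMeasure γ)

/-- The law of `λ_t` under `P_x`, i.e. when `λ_0 = x`. -/
def transitionLaw (a β γ t x : ℝ) : Measure ℝ :=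
  (drivingLaw γ).map fun ω => intensity a β x (fun n => (ω n).1) (fun n => (ω n).2) t

/-- `ν` is a stationary distribution of the intensity process: a probability measure on the state
space `[a, ∞)` with `∫ P_x (λ_t ∈ B) ν(dx) = ν(B)` for all `t ≥ 0` and all Borel sets `B`. -/
structure IsStationaryLaw (a β γ : ℝ) (ν : Measure ℝ) : Prop where
  isProbabilityMeasure : IsProbabilityMeasure ν
  support : ν (Set.Iio a) = 0
  invariant : ∀ t : ℝ, 0 ≤ t → ∀ B : Set ℝ, MeasurableSet B →
    ∫⁻ x, transitionLaw a β γ t x B ∂ν = ν B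

end MarkovHawkes

end

namespace MarkovHawkes

open Real Set Filter Topology

/-! The excess X = λ - a is an affine process: its Laplace transform is exponential-affine in the
starting point. For u > 0 let ψ solve ψ' = -ψ(βψ + βγ - 1)/(γ + ψ) with ψ(0) = u, and put L(v) =
(a/β) log(βγ - 1 + βv). Then E_w exp(-u X_t) = exp(-w ψ(t) + L(ψ(t)) - L(u)), which is
`integral_exp_neg_mul_excess`. The Gamma law has Laplace transform exp(L(0) - L(u)), so starting
from it the factors telescope and the law is preserved. For an arbitrary invariant law, letting t →
∞ sends ψ(t) to 0 and leaves exp(L(0) - L(u)). Laplace transforms determine laws on the half-line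
(`ext_of_integral_exp_neg_mul`), which gives existence and uniqueness.

The transform formula is reached without generators. With a fixed horizon, the process is observed
only at its jumps; the candidate formula solves the first-jump equation (`integral_profile_step`),
so its mean along this chain is constant. The chain reaches the horizon after finitely many jumps:
the variables β e_i - y_i have mean β - 1/γ > 0, and the strong law together with `jump_balance`
drives the event times to infinity. Dominated convergence then passes to the limit. -/

/-! ### Gamma and exponential laws. -/

theorem ae_pos_gammaMeasure (s r : ℝ) : ∀ᵐ x ∂gammaMeasure s r, 0 < x := by
  have h : gammaMeasure s r (Iic 0) = 0 := by
    rw [gammaMeasure, withDensity_apply _ measurableSet_Iic, ← Iio_union_right,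
      setLIntegral_congr (t := Iio 0), lintegral_gammaPDF_of_nonpos le_rfl]
    rw [Iio_union_right]
    exact Iio_ae_eq_Iic.symm
  rw [ae_iff]
  convert h using 2
  ext x
  simp

theorem gammaMeasure_eq_withDensity_restrict (s r : ℝ) :
    gammaMeasure s r = (volume.restrict (Ioi 0)).withDensity (gammaPDF s r) := by
  have h := Measure.restrict_eq_self_of_ae_mem (μ := gammaMeasure s r) (s := Ioi 0)
    (ae_pos_gammaMeasure s r)
  rw [← h, gammaMeasure, restrict_withDensity measurableSet_Ioi]

theorem integral_gammaMeasure {s r : ℝ} (hs : 0 < s) (hr : 0 < r) (f : ℝ → ℝ) :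
    ∫ x, f x ∂gammaMeasure s r =
      ∫ x in Ioi 0, r ^ s / Gamma s * x ^ (s - 1) * exp (-(r * x)) * f x := by
  rw [gammaMeasure_eq_withDensity_restrict, integral_withDensity_eq_integral_toReal_smul
    (by unfold gammaPDF; fun_prop) (by simp [gammaPDF])]
  refine setIntegral_congr_fun measurableSet_Ioi fun x hx => ?_
  have hx' : 0 ≤ x := le_of_lt hx
  simp only [gammaPDF]
  rw [ENNReal.toReal_ofReal (gammaPDFReal_nonneg hs hr x), gammaPDFReal, if_pos hx', smul_eq_mul]

theorem integrable_gammaMeasure_iff {s r : ℝ} (hs : 0 < s) (hr : 0 < r) (f : ℝ → ℝ) :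
    Integrable f (gammaMeasure s r) ↔
      IntegrableOn (fun x => r ^ s / Gamma s * x ^ (s - 1) * exp (-(r * x)) * f x) (Ioi 0) := by
  rw [gammaMeasure_eq_withDensity_restrict, integrable_withDensity_iff_integrable_smul'
    (by unfold gammaPDF; fun_prop) (by simp [gammaPDF])]
  refine integrableOn_congr_fun (fun x hx => ?_) measurableSet_Ioi
  have hx' : 0 ≤ x := le_of_lt hx
  simp only [gammaPDF]
  rw [ENNReal.toReal_ofReal (gammaPDFReal_nonneg hs hr x), gammaPDFReal, if_pos hx', smul_eq_mul]

/-- Laplace transform of the Gamma law. -/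
theorem integral_exp_neg_mul_gammaMeasure {s r u : ℝ} (hs : 0 < s) (hr : 0 < r) (hu : 0 ≤ u) :
    ∫ x, exp (-u * x) ∂gammaMeasure s r = (r / (r + u)) ^ s := by
  have hru : 0 < r + u := by linarith
  rw [integral_gammaMeasure hs hr]
  have h : ∀ x : ℝ, r ^ s / Gamma s * x ^ (s - 1) * exp (-(r * x)) * exp (-u * x) =
      r ^ s / Gamma s * (x ^ (s - 1) * exp (-((r + u) * x))) := by
    intro x
    rw [mul_assoc, ← exp_add]
    ring_nf
  simp_rw [h]
  rw [integral_const_mul, integral_rpow_mul_exp_neg_mul_Ioi hs hru, div_rpow hr.le hru.le,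
    div_rpow zero_le_one hru.le, one_rpow]
  have := (Gamma_pos_of_pos hs).ne'
  field_simp

theorem integral_exp_neg_mul_expMeasure {r u : ℝ} (hr : 0 < r) (hu : 0 ≤ u) :
    ∫ x, exp (-u * x) ∂expMeasure r = r / (r + u) := by
  rw [expMeasure, integral_exp_neg_mul_gammaMeasure one_pos hr hu, rpow_one]

theorem integral_expMeasure {r : ℝ} (hr : 0 < r) (f : ℝ → ℝ) :
    ∫ x, f x ∂expMeasure r = ∫ x in Ioi 0, r * exp (-(r * x)) * f x := by
  rw [expMeasure, integral_gammaMeasure one_pos hr]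
  simp

theorem integrable_id_expMeasure {r : ℝ} (hr : 0 < r) :
    Integrable (fun x : ℝ => x) (expMeasure r) := by
  rw [expMeasure, integrable_gammaMeasure_iff one_pos hr]
  have h := (integrableOn_rpow_mul_exp_neg_mul_rpow (s := 1) (p := 1) (b := r) (by norm_num)
    one_pos hr).const_mul r
  refine (integrableOn_congr_fun (fun x _ => ?_) measurableSet_Ioi).mp h
  simp
  ring

theorem integral_id_expMeasure {r : ℝ} (hr : 0 < r) :
    ∫ x, x ∂expMeasure r = 1 / r := by
  rw [integral_expMeasure hr]
  have h := integral_rpow_mul_exp_neg_mul_Ioi (a := 2) (r := r) two_pos hr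
  have e : ∀ x : ℝ, r * exp (-(r * x)) * x = r * (x ^ ((2 : ℝ) - 1) * exp (-(r * x))) := by
    intro x
    norm_num
    ring
  simp_rw [e]
  rw [integral_const_mul, h]
  norm_num
  field_simp

/-! ### Laplace transforms determine laws on the half-line. -/

/-- Finite measures on the unit interval with the same moments agree. -/
theorem ext_of_integral_pow_unitInterval {μ ν : Measure unitInterval} [IsFiniteMeasure μ]
    [IsFiniteMeasure ν] (h : ∀ n : ℕ, ∫ x, (x : ℝ) ^ n ∂μ = ∫ x, (x : ℝ) ^ n ∂ν) : μ = ν := by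
  let f : BoundedContinuousFunction unitInterval ℝ :=
    BoundedContinuousFunction.mkOfCompact ⟨fun x => (x : ℝ), continuous_subtype_val⟩
  let A : StarSubalgebra ℝ (BoundedContinuousFunction unitInterval ℝ) :=
    { Algebra.adjoin ℝ {f} with
      star_mem' := by
        intro a ha
        have : star a = a := by ext x; simp
        rw [this]
        exact ha }
  -- Stone–Weierstrass: polynomials in the coordinate separate points, and moments determine their
  -- integrals.
  refine ext_of_forall_mem_subalgebra_integral_eq_of_polish (𝕜 := ℝ) (A := A) ?_ ?_
  · intro x y hxy
    refine ⟨f, ⟨f, ⟨f, ?_, rfl⟩, rfl⟩, ?_⟩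
    · exact Algebra.subset_adjoin (mem_singleton f)
    · simpa [f] using fun h' => hxy (Subtype.ext h')
  · intro g hg
    have hg' : g ∈ Algebra.adjoin ℝ {f} := hg
    rw [Algebra.adjoin_singleton_eq_range_aeval] at hg'
    obtain ⟨p, rfl⟩ := hg'
    clear hg
    simp only [AlgHom.toRingHom_eq_coe, RingHom.coe_coe]
    induction p using Polynomial.induction_on' with
    | add p q hp hq =>
      simp only [map_add, BoundedContinuousFunction.coe_add, Pi.add_apply]
      rw [integral_add (BoundedContinuousFunction.integrable _ _)
        (BoundedContinuousFunction.integrable _ _),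
        integral_add (BoundedContinuousFunction.integrable _ _)
        (BoundedContinuousFunction.integrable _ _), hp, hq]
    | monomial n c =>
      have e : ∀ x, (Polynomial.aeval f (Polynomial.monomial n c)) x = c * (x : ℝ) ^ n := by
        intro x
        rw [Polynomial.aeval_monomial]
        simp [f, BoundedContinuousFunction.algebraMap_apply]
      simp_rw [e]
      rw [integral_const_mul, integral_const_mul, h]

/-- Probability measures on the nonnegative half-line are determined by their Laplace
transforms. -/
theorem ext_of_integral_exp_neg_mul {μ ν : Measure ℝ} [IsProbabilityMeasure μ]
    [IsProbabilityMeasure ν] (hμ : ∀ᵐ x ∂μ, 0 ≤ x) (hν : ∀ᵐ x ∂ν, 0 ≤ x)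
    (h : ∀ u : ℝ, 0 < u → ∫ x, exp (-u * x) ∂μ = ∫ x, exp (-u * x) ∂ν) : μ = ν := by
  -- Under x ↦ exp(-x) the Laplace transform at an integer n becomes the n-th moment. The truncation
  -- `max x 0` only makes the map total.
  let T : ℝ → unitInterval := fun x =>
    ⟨exp (-max x 0), (exp_pos _).le, exp_le_one_iff.mpr (by simp)⟩
  have hT : Measurable T := by
    refine Measurable.subtype_mk ?_
    fun_prop
  have hlog : Measurable fun v : unitInterval => -log (v : ℝ) := by fun_prop
  have back : ∀ ρ : Measure ℝ, (∀ᵐ x ∂ρ, 0 ≤ x) →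
      (ρ.map T).map (fun v : unitInterval => -log (v : ℝ)) = ρ := by
    intro ρ hρ
    rw [Measure.map_map hlog hT]
    conv_rhs => rw [← Measure.map_id (μ := ρ)]
    refine Measure.map_congr ?_
    filter_upwards [hρ] with x hx
    simp [T, hx]
  have pow : ∀ ρ : Measure ℝ, (∀ᵐ x ∂ρ, 0 ≤ x) → ∀ n : ℕ,
      ∫ v, (v : ℝ) ^ n ∂(ρ.map T) = ∫ x, exp (-(n : ℝ) * x) ∂ρ := by
    intro ρ hρ n
    rw [integral_map hT.aemeasurable (by fun_prop)]
    refine integral_congr_ae ?_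
    filter_upwards [hρ] with x hx
    simp only [T, max_eq_left hx, ← exp_nat_mul]
    ring_nf
  have : IsProbabilityMeasure (μ.map T) := Measure.isProbabilityMeasure_map hT.aemeasurable
  have : IsProbabilityMeasure (ν.map T) := Measure.isProbabilityMeasure_map hT.aemeasurable
  rw [← back μ hμ, ← back ν hν]
  congr 1
  refine ext_of_integral_pow_unitInterval fun n => ?_
  rw [pow μ hμ, pow ν hν]
  -- The hypothesis excludes u = 0; there both sides are total masses, equal to 1.
  rcases Nat.eq_zero_or_pos n with rfl | hn
  · simp
  · exact h n (by exact_mod_cast hn)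

/-! ### The Riccati-type equation. -/

/-- In the coordinate `w = log v`, the antiderivative of `(γ + v) / (v (β v + c))`, where
`c = β γ - 1`. -/
noncomputable def riccatiPotential (β γ w : ℝ) : ℝ :=
  γ / (β * γ - 1) * w - 1 / (β * (β * γ - 1)) * log (β * exp w + (β * γ - 1))

/-- With ψ = exp w the equation reads w' = -(β exp w + βγ - 1)/(exp w + γ). The derivative here is
the reciprocal of that speed, so the potential decreases at unit rate along solutions. -/
theorem hasDerivAt_riccatiPotential {β γ : ℝ} (hβ : 0 < β) (hβγ : 1 < β * γ) (w : ℝ) :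
    HasDerivAt (riccatiPotential β γ) ((exp w + γ) / (β * exp w + (β * γ - 1))) w := by
  have hc : 0 < β * γ - 1 := by linarith
  have hp : 0 < β * exp w + (β * γ - 1) := by positivity
  have h1 : HasDerivAt (fun w => β * exp w + (β * γ - 1)) (β * exp w) w :=
    ((hasDerivAt_exp w).const_mul β).add_const _
  have h2 := ((hasDerivAt_id w).const_mul (γ / (β * γ - 1))).sub
    ((h1.log hp.ne').const_mul (1 / (β * (β * γ - 1))))
  refine h2.congr_deriv ?_
  have hp' := hp.ne'
  have hc' := hc.ne'
  have hβ' := hβ.ne'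
  rw [mul_one, div_mul_div_comm, one_mul, div_sub_div _ _ hc' (by positivity),
    div_eq_div_iff (by positivity) hp']
  ring

theorem strictMono_riccatiPotential {β γ : ℝ} (hβ : 0 < β) (hγ : 0 < γ) (hβγ : 1 < β * γ) :
    StrictMono (riccatiPotential β γ) := by
  refine strictMono_of_deriv_pos fun w => ?_
  rw [(hasDerivAt_riccatiPotential hβ hβγ w).deriv]
  have hc : 0 < β * γ - 1 := by linarith
  positivity

theorem riccatiPotential_surjective {β γ : ℝ} (hβ : 0 < β) (hβγ : 1 < β * γ) :
    Function.Surjective (riccatiPotential β γ) := by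
  have hc : 0 < β * γ - 1 := by linarith
  have hcont : Continuous (riccatiPotential β γ) :=
    continuous_iff_continuousAt.mpr fun w => (hasDerivAt_riccatiPotential hβ hβγ w).continuousAt
  -- The slope is at least 1/β because β(exp w + γ) exceeds β exp w + βγ - 1; a linear comparison
  -- then handles both ends.
  have hd : ∀ w, HasDerivAt (fun w => riccatiPotential β γ w - 1 / β * w)
      ((exp w + γ) / (β * exp w + (β * γ - 1)) - 1 / β) w := fun w =>
    (hasDerivAt_riccatiPotential hβ hβγ w).sub
      (((hasDerivAt_id w).const_mul (1 / β)).congr_deriv (mul_one _))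
  have hmono : Monotone fun w => riccatiPotential β γ w - 1 / β * w := by
    refine monotone_of_deriv_nonneg (fun w => (hd w).differentiableAt) fun w => ?_
    rw [(hd w).deriv, sub_nonneg, div_le_div_iff₀ hβ (by positivity)]
    linarith
  have hb : 0 < 1 / β := by positivity
  refine hcont.surjective ?_ ?_
  · refine tendsto_atTop_mono' atTop (f₁ := fun w => 1 / β * w + (riccatiPotential β γ 0)) ?_
      (tendsto_atTop_add_const_right _ _ (tendsto_id.const_mul_atTop hb))
    filter_upwards [eventually_ge_atTop 0] with w hw
    have := hmono hw
    simp only at this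
    linarith
  · refine tendsto_atBot_mono' atBot (f₁ := fun w => 1 / β * w + (riccatiPotential β γ 0)) ?_
      (tendsto_atBot_add_const_right _ _ (tendsto_id.const_mul_atBot hb))
    filter_upwards [eventually_le_atBot 0] with w hw
    have := hmono hw
    simp only at this
    linarith

/-- Global solution of the Riccati-type equation governing the Laplace exponent. -/
theorem exists_riccati {β γ u : ℝ} (hβ : 0 < β) (hγ : 0 < γ) (hβγ : 1 < β * γ) (hu : 0 < u) :
    ∃ ψ : ℝ → ℝ, ψ 0 = u ∧ (∀ t, 0 < ψ t) ∧
      (∀ t, HasDerivAt ψ (-(ψ t * (β * ψ t + (β * γ - 1)) / (γ + ψ t))) t) ∧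
      Antitone ψ ∧ Tendsto ψ atTop (𝓝 0) := by
  have hc : 0 < β * γ - 1 := by linarith
  let q := (strictMono_riccatiPotential hβ hγ hβγ).orderIsoOfSurjective _
    (riccatiPotential_surjective hβ hβγ)
  have hq : ∀ w, q w = riccatiPotential β γ w := fun w => rfl
  have hd : ∀ r, HasDerivAt (fun r => q.symm r)
      ((exp (q.symm r) + γ) / (β * exp (q.symm r) + (β * γ - 1)))⁻¹ r := by
    intro r
    refine HasDerivAt.of_local_left_inverse (f := riccatiPotential β γ)
      q.symm.continuous.continuousAt (hasDerivAt_riccatiPotential hβ hβγ _) (by positivity) ?_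
    exact Eventually.of_forall fun s => by rw [← hq, q.apply_symm_apply]
  have hanti : Antitone fun t => exp (q.symm (riccatiPotential β γ (log u) - t)) := by
    intro s t hst
    exact exp_le_exp.mpr (q.symm.monotone (by linarith))
  -- The potential is inverted along its unit-rate descent from log u; its surjectivity makes the
  -- solution global.
  refine ⟨fun t => exp (q.symm (riccatiPotential β γ (log u) - t)), ?_, fun t => exp_pos _,
    fun t => ?_, hanti, ?_⟩
  · simp only [sub_zero]
    rw [← hq, q.symm_apply_apply, exp_log hu]
  · have h1 := ((hd (riccatiPotential β γ (log u) - t)).comp t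
      ((hasDerivAt_id t).const_sub (riccatiPotential β γ (log u)))).exp
    refine h1.congr_deriv ?_
    simp only [Function.comp]
    set v := exp (q.symm (riccatiPotential β γ (log u) - t))
    have hv : 0 < v := exp_pos _
    have : β * v + (β * γ - 1) ≠ 0 := by positivity
    field_simp
    ring
  · refine tendsto_exp_atBot.comp (q.symm.tendsto_atBot.comp ?_)
    exact tendsto_atBot_add_const_left _ _ tendsto_neg_atTop_atBot

/-! ### Cumulative hazard and waiting times. -/

/-- Intensity accumulated in a time span `r` without events, starting from excess intensity
`w = λ - a` (its positive part). -/
noncomputable def cumHazard (a β w r : ℝ) : ℝ := a * r + max w 0 * ((1 - exp (-β * r)) / β)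

/-- Waiting time until the accumulated intensity reaches `e`. -/
noncomputable def hitTime (a β w e : ℝ) : ℝ := sInf {r : ℝ | 0 ≤ r ∧ e ≤ cumHazard a β w r}

theorem hasDerivAt_cumHazard {β : ℝ} (hβ : β ≠ 0) (a w r : ℝ) :
    HasDerivAt (cumHazard a β w) (a + max w 0 * exp (-β * r)) r := by
  have h1 : HasDerivAt (fun r => exp (-β * r)) (exp (-β * r) * (-β)) r := by
    simpa using ((hasDerivAt_id r).const_mul (-β)).exp
  have h2 := ((hasDerivAt_id r).const_mul a).add
    (((h1.const_sub 1).div_const β).const_mul (max w 0))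
  refine h2.congr_deriv ?_
  field_simp

theorem continuous_cumHazard (a β w : ℝ) : Continuous (cumHazard a β w) := by
  unfold cumHazard
  fun_prop

theorem measurable_cumHazard (a β : ℝ) :
    Measurable fun p : ℝ × ℝ => cumHazard a β p.1 p.2 := by
  unfold cumHazard
  fun_prop

/-- The positive part in `cumHazard` keeps the rate at least a for every real w, so no sign
condition is needed and `hitTime` is measurable on the whole plane. -/
theorem strictMono_cumHazard {a β : ℝ} (ha : 0 < a) (hβ : 0 < β) (w : ℝ) :
    StrictMono (cumHazard a β w) := by
  refine strictMono_of_deriv_pos fun r => ?_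
  rw [(hasDerivAt_cumHazard hβ.ne' a w r).deriv]
  positivity

@[simp]
theorem cumHazard_zero (a β w : ℝ) : cumHazard a β w 0 = 0 := by simp [cumHazard]

/-- The baseline alone forces every threshold to be reached in finite time. -/
theorem mul_le_cumHazard {β r : ℝ} (hβ : 0 < β) (hr : 0 ≤ r) (a w : ℝ) :
    a * r ≤ cumHazard a β w r := by
  have h : exp (-β * r) ≤ 1 := exp_le_one_iff.mpr (by nlinarith)
  have : 0 ≤ max w 0 * ((1 - exp (-β * r)) / β) :=
    mul_nonneg (le_max_right _ _) (div_nonneg (by linarith) hβ.le)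
  unfold cumHazard
  linarith

theorem hitTime_mem {a β : ℝ} (ha : 0 < a) (hβ : 0 < β) (w e : ℝ) :
    hitTime a β w e ∈ {r : ℝ | 0 ≤ r ∧ e ≤ cumHazard a β w r} := by
  refine IsClosed.csInf_mem ?_ ⟨max 0 (e / a), le_max_left _ _, ?_⟩ ⟨0, fun r hr => hr.1⟩
  · exact isClosed_Ici.inter (isClosed_le continuous_const (continuous_cumHazard a β w))
  · refine le_trans ?_ (mul_le_cumHazard hβ (le_max_left _ _) a w)
    calc e = a * (e / a) := by field_simp
      _ ≤ _ := by gcongr; exact le_max_right _ _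

theorem hitTime_nonneg {a β : ℝ} (ha : 0 < a) (hβ : 0 < β) (w e : ℝ) : 0 ≤ hitTime a β w e :=
  (hitTime_mem ha hβ w e).1

theorem hitTime_le_iff {a β r : ℝ} (ha : 0 < a) (hβ : 0 < β) (hr : 0 ≤ r) (w e : ℝ) :
    hitTime a β w e ≤ r ↔ e ≤ cumHazard a β w r := by
  constructor
  · intro h
    exact (hitTime_mem ha hβ w e).2.trans ((strictMono_cumHazard ha hβ w).monotone h)
  · intro h
    exact csInf_le ⟨0, fun r hr => hr.1⟩ ⟨hr, h⟩

theorem hitTime_cumHazard {a β r : ℝ} (ha : 0 < a) (hβ : 0 < β) (hr : 0 ≤ r) (w : ℝ) :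
    hitTime a β w (cumHazard a β w r) = r :=
  le_antisymm ((hitTime_le_iff ha hβ hr w _).mpr le_rfl)
    ((strictMono_cumHazard ha hβ w).le_iff_le.mp (hitTime_mem ha hβ w _).2)

theorem cumHazard_hitTime {a β e : ℝ} (ha : 0 < a) (hβ : 0 < β) (he : 0 ≤ e) (w : ℝ) :
    cumHazard a β w (hitTime a β w e) = e := by
  have hb : e ≤ cumHazard a β w (e / a) := by
    refine le_trans ?_ (mul_le_cumHazard hβ (div_nonneg he ha.le) a w)
    rw [mul_div_cancel₀ _ ha.ne']
  obtain ⟨r, hr, hre⟩ := intermediate_value_Icc (div_nonneg he ha.le)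
    (continuous_cumHazard a β w).continuousOn ⟨by simpa using he, hb⟩
  rw [← hre, hitTime_cumHazard ha hβ hr.1]

theorem hitTime_pos {a β e : ℝ} (ha : 0 < a) (hβ : 0 < β) (he : 0 < e) (w : ℝ) :
    0 < hitTime a β w e := by
  refine (hitTime_nonneg ha hβ w e).lt_of_ne fun h => ?_
  have := cumHazard_hitTime ha hβ he.le w
  rw [← h, cumHazard_zero] at this
  linarith

theorem measurable_hitTime {a β : ℝ} (ha : 0 < a) (hβ : 0 < β) :
    Measurable fun p : ℝ × ℝ => hitTime a β p.1 p.2 := by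
  refine measurable_of_Iic fun r => ?_
  rcases lt_or_ge r 0 with hr | hr
  · convert MeasurableSet.empty
    ext p
    simpa using hr.trans_le (hitTime_nonneg ha hβ _ _)
  · have : (fun p : ℝ × ℝ => hitTime a β p.1 p.2) ⁻¹' Iic r =
        {p : ℝ × ℝ | p.2 ≤ cumHazard a β p.1 r} := by
      ext p
      exact hitTime_le_iff ha hβ hr _ _
    rw [this]
    refine measurableSet_le measurable_snd ?_
    unfold cumHazard
    fun_prop

/-! ### The first-jump identity. -/

/-- One transition of the process observed on a finite horizon.  The state is the pair of the
remaining time and the excess intensity; a negative remaining time means that the horizon has been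
reached, and the excess intensity is then frozen. -/
noncomputable def step (a β : ℝ) (p q : ℝ × ℝ) : ℝ × ℝ :=
  if p.1 < 0 then p
  else if q.1 ≤ cumHazard a β p.2 p.1 then
    (p.1 - hitTime a β p.2 q.1, p.2 * exp (-β * hitTime a β p.2 q.1) + q.2)
  else (-1, p.2 * exp (-β * p.1))

theorem measurable_step {a β : ℝ} (ha : 0 < a) (hβ : 0 < β) :
    Measurable fun z : (ℝ × ℝ) × (ℝ × ℝ) => step a β z.1 z.2 := by
  have h1 : Measurable fun z : (ℝ × ℝ) × (ℝ × ℝ) => hitTime a β z.1.2 z.2.1 :=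
    (measurable_hitTime ha hβ).comp (f := fun z : (ℝ × ℝ) × (ℝ × ℝ) => (z.1.2, z.2.1))
      (by fun_prop)
  have h2 : Measurable fun z : (ℝ × ℝ) × (ℝ × ℝ) => cumHazard a β z.1.2 z.1.1 :=
    (measurable_cumHazard a β).comp (f := fun z : (ℝ × ℝ) × (ℝ × ℝ) => (z.1.2, z.1.1))
      (by fun_prop)
  refine Measurable.ite (measurableSet_lt (by fun_prop) (by fun_prop)) (by fun_prop)
    (Measurable.ite (measurableSet_le (by fun_prop) h2) ?_ (by fun_prop))
  fun_prop

theorem step_snd_nonneg {a β : ℝ} {p q : ℝ × ℝ} (hp : 0 ≤ p.2) (hq : 0 ≤ q.2) :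
    0 ≤ (step a β p q).2 := by
  unfold step
  split_ifs
  · exact hp
  · positivity
  · positivity

/-- Logarithm of the normalising factor in the Laplace transform of the Gamma law. -/
noncomputable def logFactor (a β γ v : ℝ) : ℝ := a / β * log (β * γ - 1 + β * v)

/-- Candidate for the conditional Laplace transform of the excess intensity at the horizon. -/
noncomputable def profile (a β γ u : ℝ) (ψ : ℝ → ℝ) (p : ℝ × ℝ) : ℝ :=
  if p.1 < 0 then exp (-u * p.2)
  else exp (-p.2 * ψ p.1 + logFactor a β γ (ψ p.1) - logFactor a β γ u)

theorem measurable_profile {ψ : ℝ → ℝ} (hψ : Measurable ψ) (a β γ u : ℝ) :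
    Measurable (profile a β γ u ψ) := by
  refine Measurable.ite (measurableSet_lt (by fun_prop) (by fun_prop)) (by fun_prop) ?_
  unfold logFactor
  fun_prop

theorem profile_nonneg (a β γ u : ℝ) (ψ : ℝ → ℝ) (p : ℝ × ℝ) : 0 ≤ profile a β γ u ψ p := by
  unfold profile
  split_ifs <;> exact (exp_pos _).le

/-- Solutions of the Riccati-type equation started from `u`. -/
structure IsRiccati (β γ u : ℝ) (ψ : ℝ → ℝ) : Prop where
  zero : ψ 0 = u
  pos : ∀ t, 0 < ψ t
  hasDerivAt : ∀ t, HasDerivAt ψ (-(ψ t * (β * ψ t + (β * γ - 1)) / (γ + ψ t))) t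
  antitone : Antitone ψ
  tendsto : Tendsto ψ atTop (𝓝 0)

theorem logFactor_le {a β γ v v' : ℝ} (ha : 0 < a) (hβ : 0 < β) (hβγ : 1 < β * γ) (hv : 0 < v)
    (h : v ≤ v') : logFactor a β γ v ≤ logFactor a β γ v' := by
  have : 0 < β * γ - 1 := by linarith
  unfold logFactor
  gcongr

/-- For nonnegative remaining time ψ is at most u and `logFactor` is increasing, so the exponent is
nonpositive. This bound supplies integrability and domination. -/
theorem profile_le_one {a β γ u : ℝ} {ψ : ℝ → ℝ} (ha : 0 < a) (hβ : 0 < β) (hβγ : 1 < β * γ)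
    (hu : 0 < u) (hψ : IsRiccati β γ u ψ) {p : ℝ × ℝ} (hp : 0 ≤ p.2) :
    profile a β γ u ψ p ≤ 1 := by
  unfold profile
  split_ifs with h
  · exact exp_le_one_iff.mpr (by nlinarith)
  · have h1 : ψ p.1 ≤ u := hψ.zero ▸ hψ.antitone (not_lt.mp h)
    have h2 := logFactor_le ha hβ hβγ (hψ.pos p.1) h1
    have h3 := mul_nonneg hp (hψ.pos p.1).le
    exact exp_le_one_iff.mpr (by linarith)

/-- Infinitesimal form of the first-jump equation: along the flow before the jump, the
survival-weighted profile loses exactly intensity times survival times the profile averaged over a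
shock. -/
theorem hasDerivAt_survival_mul_profile {a β γ u : ℝ} {ψ : ℝ → ℝ} (hβ : 0 < β) (hγ : 0 < γ)
    (hβγ : 1 < β * γ) (hψ : IsRiccati β γ u ψ) {w : ℝ} (hw : 0 ≤ w) (R r : ℝ) :
    HasDerivAt (fun r => exp (-cumHazard a β w r + (-(w * exp (-β * r)) * ψ (R - r) +
        logFactor a β γ (ψ (R - r)) - logFactor a β γ u)))
      (-((a + w * exp (-β * r)) * (exp (-cumHazard a β w r) *
        (exp (-(w * exp (-β * r)) * ψ (R - r) +
        logFactor a β γ (ψ (R - r)) - logFactor a β γ u) * (γ / (γ + ψ (R - r))))))) r := by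
  have hc : 0 < β * γ - 1 := by linarith
  have hv := hψ.pos (R - r)
  have h1 : HasDerivAt (fun r => exp (-β * r)) (exp (-β * r) * (-β)) r := by
    simpa using ((hasDerivAt_id r).const_mul (-β)).exp
  have h2 := (hψ.hasDerivAt (R - r)).comp r ((hasDerivAt_id r).const_sub R)
  have hl : 0 < β * γ - 1 + β * ψ (R - r) := by positivity
  have h3 := (((h2.const_mul β).const_add (β * γ - 1)).log hl.ne').const_mul (a / β)
  have h4 := ((hasDerivAt_cumHazard hβ.ne' a w r).neg.add
    ((((h1.const_mul w).neg.mul h2).add h3).sub_const (logFactor a β γ u))).exp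
  refine h4.congr_deriv ?_
  simp only [Function.comp, Pi.add_apply, Pi.mul_apply, Pi.neg_apply, max_eq_left hw]
  -- The identity is affine in w * E: the Riccati equation matches the terms containing w, and the
  -- choice of `logFactor` matches those containing a.
  have key : ∀ E v : ℝ, 0 < v → -(a + w * E) + (-(w * (E * -β)) * v +
      -(w * E) * (-(v * (β * v + (β * γ - 1)) / (γ + v)) * -1) +
      a / β * (β * (-(v * (β * v + (β * γ - 1)) / (γ + v)) * -1) / (β * γ - 1 + β * v))) =
      -((a + w * E) * (γ / (γ + v))) := by
    intro E v hv
    have hD : β * γ - 1 + β * v ≠ 0 := by positivity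
    have hE : β * v + (β * γ - 1) = β * γ - 1 + β * v := by ring
    have hg : γ + v ≠ 0 := by positivity
    rw [hE]
    generalize hDv : β * γ - 1 + β * v = D at hD
    field_simp
    rw [← hDv]
    ring
  rw [key _ _ hv, exp_add, logFactor, logFactor]
  ring

/-- Average of the profile over an exponential shock. -/
theorem integral_profile_shock {a β γ u : ℝ} {ψ : ℝ → ℝ} (hγ : 0 < γ)
    (hψ : IsRiccati β γ u ψ) {R : ℝ} (hR : 0 ≤ R) (w : ℝ) :
    ∫ y, profile a β γ u ψ (R, w + y) ∂expMeasure γ =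
      exp (-w * ψ R + logFactor a β γ (ψ R) - logFactor a β γ u) * (γ / (γ + ψ R)) := by
  rw [← integral_exp_neg_mul_expMeasure hγ (hψ.pos R).le, ← integral_const_mul]
  congr 1 with y
  rw [profile, if_neg (not_lt.mpr hR), ← exp_add]
  ring_nf

/-- Prepares the substitution e = Λ(r), which turns the exponential density of the threshold into
the waiting-time density Λ'(r) exp(-Λ(r)). -/
theorem image_cumHazard {a β : ℝ} (ha : 0 < a) (hβ : 0 < β) (w : ℝ) {R : ℝ} (hR : 0 ≤ R) :
    cumHazard a β w '' Ioc 0 R = Ioc 0 (cumHazard a β w R) := by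
  have hmono := strictMono_cumHazard ha hβ w
  ext e
  constructor
  · rintro ⟨r, hr, rfl⟩
    refine ⟨?_, hmono.monotone hr.2⟩
    simpa using hmono hr.1
  · intro he
    exact ⟨hitTime a β w e, ⟨hitTime_pos ha hβ he.1 w, (hitTime_le_iff ha hβ hR w e).mpr he.2⟩,
      cumHazard_hitTime ha hβ he.1.le w⟩

/-- Thresholds above L mean no event before the horizon; they contribute the survival probability
exp(-L) times a constant. -/
theorem integral_exp_neg_Ioi_split {f : ℝ → ℝ} {L K : ℝ} (hL : 0 ≤ L)
    (hf : IntegrableOn (fun e => exp (-e) * f e) (Ioc 0 L)) (hK : ∀ e, L < e → f e = K) :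
    ∫ e in Ioi 0, exp (-e) * f e = (∫ e in Ioc 0 L, exp (-e) * f e) + exp (-L) * K := by
  have hc : ∀ e ∈ Ioi L, exp (-e) * f e = exp (-e) * K := fun e he => by rw [hK e he]
  have hi : IntegrableOn (fun e => exp (-e) * K) (Ioi L) :=
    (integrableOn_exp_neg_Ioi L).mul_const K
  rw [← Ioc_union_Ioi_eq_Ioi hL, setIntegral_union (Ioc_disjoint_Ioi le_rfl) measurableSet_Ioi hf
    (hi.congr_fun (fun e he => (hc e he).symm) measurableSet_Ioi),
    setIntegral_congr_fun measurableSet_Ioi hc, integral_mul_const, integral_exp_neg_Ioi]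

/-- The first-jump decomposition solved by the profile. -/
theorem integral_profile_step {a β γ u : ℝ} {ψ : ℝ → ℝ} (ha : 0 < a) (hβ : 0 < β) (hγ : 0 < γ)
    (hβγ : 1 < β * γ) (hu : 0 < u) (hψ : IsRiccati β γ u ψ) {p : ℝ × ℝ} (hp : 0 ≤ p.2) :
    ∫ q, profile a β γ u ψ (step a β p q) ∂(expMeasure 1).prod (expMeasure γ) =
      profile a β γ u ψ p := by
  have : IsProbabilityMeasure (expMeasure 1) := isProbabilityMeasure_expMeasure one_pos
  have : IsProbabilityMeasure (expMeasure γ) := isProbabilityMeasure_expMeasure hγ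
  have hψc : Continuous ψ :=
    continuous_iff_continuousAt.mpr fun t => (hψ.hasDerivAt t).continuousAt
  obtain ⟨R, w⟩ := p
  rcases lt_or_ge R 0 with hR | hR
  · simp [step, hR]
  have hw : 0 ≤ w := hp
  have hmeas : Measurable fun q => profile a β γ u ψ (step a β (R, w) q) :=
    (measurable_profile hψc.measurable a β γ u).comp
      ((measurable_step ha hβ).comp (measurable_const.prodMk measurable_id))
  have hy : ∀ᵐ y ∂expMeasure γ, 0 < y := ae_pos_gammaMeasure 1 γ
  have hsnd : ∀ᵐ q ∂(expMeasure 1).prod (expMeasure γ), 0 < q.2 :=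
    Measure.quasiMeasurePreserving_snd.ae hy
  have hint : Integrable (fun q => profile a β γ u ψ (step a β (R, w) q))
      ((expMeasure 1).prod (expMeasure γ)) := by
    refine Integrable.of_bound hmeas.aestronglyMeasurable 1 ?_
    filter_upwards [hsnd] with q hq
    rw [norm_of_nonneg (profile_nonneg _ _ _ _ _ _)]
    exact profile_le_one ha hβ hβγ hu hψ (step_snd_nonneg hp hq.le)
  rw [integral_prod _ hint]
  set Λ := cumHazard a β w
  -- the survival-weighted profile along the deterministic flow
  let K : ℝ → ℝ := fun r => exp (-Λ r + (-(w * exp (-β * r)) * ψ (R - r) +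
        logFactor a β γ (ψ (R - r)) - logFactor a β γ u))
  let M : ℝ → ℝ := fun r => exp (-(w * exp (-β * r)) * ψ (R - r) +
        logFactor a β γ (ψ (R - r)) - logFactor a β γ u) * (γ / (γ + ψ (R - r)))
  have hMc : Continuous M := by
    have h0 : ∀ r, β * γ - 1 + β * ψ (R - r) ≠ 0 := fun r => by
      have := hψ.pos (R - r)
      have : 0 < β * γ - 1 := by linarith
      positivity
    have h1 : ∀ r, γ + ψ (R - r) ≠ 0 := fun r => by
      have := hψ.pos (R - r)
      positivity
    have h2 : Continuous fun r => logFactor a β γ (ψ (R - r)) :=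
      continuous_const.mul (Continuous.log (by fun_prop) h0)
    have h3 : Continuous fun r => γ / (γ + ψ (R - r)) :=
      Continuous.div₀ (by fun_prop) (by fun_prop) h1
    fun_prop
  have inner : ∀ e, ∫ y, profile a β γ u ψ (step a β (R, w) (e, y)) ∂expMeasure γ =
      if e ≤ Λ R then M (hitTime a β w e) else exp (-u * (w * exp (-β * R))) := by
    intro e
    simp only [step, not_lt.mpr hR, if_false]
    split_ifs with he
    · exact integral_profile_shock hγ hψ
        (sub_nonneg.mpr ((hitTime_le_iff ha hβ hR w e).mpr he)) _
    · simp [profile]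
  simp_rw [inner]
  rw [integral_expMeasure one_pos]
  simp only [one_mul]
  have hmono := strictMono_cumHazard ha hβ w
  have hΛR : 0 ≤ Λ R := by simpa using hmono.monotone hR
  have hder : ∀ r ∈ Ioc 0 R, HasDerivWithinAt Λ (a + max w 0 * exp (-β * r)) (Ioc 0 R) r :=
    fun r _ => (hasDerivAt_cumHazard hβ.ne' a w r).hasDerivWithinAt
  have himg := image_cumHazard ha hβ w hR
  have hflow : ∀ r ∈ Ioc 0 R, |a + max w 0 * exp (-β * r)| •
      (exp (-Λ r) * if Λ r ≤ Λ R then M (hitTime a β w (Λ r))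
        else exp (-u * (w * exp (-β * R)))) =
      (a + w * exp (-β * r)) * (exp (-Λ r) * M r) := by
    intro r hr
    rw [if_pos (hmono.monotone hr.2), hitTime_cumHazard ha hβ hr.1.le, smul_eq_mul,
      max_eq_left hw, abs_of_pos (by positivity)]
  have hcont : Continuous fun r => (a + w * exp (-β * r)) * (exp (-Λ r) * M r) := by
    have := continuous_cumHazard a β w
    fun_prop
  rw [integral_exp_neg_Ioi_split (L := Λ R) (K := exp (-u * (w * exp (-β * R)))) hΛR]
  rotate_left
  · rw [← himg, integrableOn_image_iff_integrableOn_abs_deriv_smul measurableSet_Ioc hder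
      hmono.injective.injOn]
    exact (integrableOn_congr_fun hflow measurableSet_Ioc).mpr
      (hcont.integrableOn_Icc.mono_set Ioc_subset_Icc_self)
  · intro e he
    rw [if_neg (not_le.mpr he)]
  rw [← himg, integral_image_eq_integral_abs_deriv_smul measurableSet_Ioc hder
    hmono.injective.injOn, setIntegral_congr_fun measurableSet_Ioc hflow,
    ← intervalIntegral.integral_of_le hR]
  -- The jump contribution is K 0 - K R, and K R is exactly the no-jump contribution, so the sum is
  -- K 0, the initial profile.
  have hftc : ∫ r in 0..R, -((a + w * exp (-β * r)) * (exp (-Λ r) * M r)) = K R - K 0 :=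
    intervalIntegral.integral_eq_sub_of_hasDerivAt
      (fun r _ => hasDerivAt_survival_mul_profile hβ hγ hβγ hψ hw R r)
    (hcont.neg.intervalIntegrable 0 R)
  rw [intervalIntegral.integral_neg] at hftc
  have hK0 : K 0 = profile a β γ u ψ (R, w) := by
    simp [K, Λ, profile, not_lt.mpr hR]
  have hKR : K R = exp (-Λ R) * exp (-u * (w * exp (-β * R))) := by
    simp only [K, sub_self, hψ.zero]
    rw [← exp_add]
    ring_nf
  rw [← hK0, ← hKR]
  linarith

/-! ### The chain of jumps and its driving sequence. -/

/-- The process observed on a finite horizon, after `n` transitions. -/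
noncomputable def chain (a β : ℝ) (p : ℝ × ℝ) (ω : ℕ → ℝ × ℝ) : ℕ → ℝ × ℝ
  | 0 => p
  | n + 1 => step a β (chain a β p ω n) (ω n)

theorem measurable_chain {a β : ℝ} (ha : 0 < a) (hβ : 0 < β) (n : ℕ) :
    Measurable fun z : (ℝ × ℝ) × (ℕ → ℝ × ℝ) => chain a β z.1 z.2 n := by
  induction n with
  | zero => exact measurable_fst
  | succ n ih =>
    exact (measurable_step ha hβ).comp (ih.prodMk (by fun_prop))

theorem chain_congr {a β : ℝ} {p : ℝ × ℝ} {ω ω' : ℕ → ℝ × ℝ} {n : ℕ}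
    (h : ∀ i < n, ω i = ω' i) : chain a β p ω n = chain a β p ω' n := by
  induction n with
  | zero => rfl
  | succ n ih =>
    simp only [chain]
    rw [ih fun i hi => h i (by omega), h n (by omega)]

theorem chain_snd_nonneg {a β : ℝ} {p : ℝ × ℝ} {ω : ℕ → ℝ × ℝ} (hp : 0 ≤ p.2)
    (hω : ∀ i, 0 ≤ (ω i).2) (n : ℕ) : 0 ≤ (chain a β p ω n).2 := by
  induction n with
  | zero => exact hp
  | succ n ih => exact step_snd_nonneg ih (hω n)

theorem isProbabilityMeasure_drivingLaw {γ : ℝ} (hγ : 0 < γ) :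
    IsProbabilityMeasure (drivingLaw γ) := by
  have : IsProbabilityMeasure (expMeasure 1) := isProbabilityMeasure_expMeasure one_pos
  have : IsProbabilityMeasure (expMeasure γ) := isProbabilityMeasure_expMeasure hγ
  unfold drivingLaw
  infer_instance

theorem map_eval_drivingLaw {γ : ℝ} (hγ : 0 < γ) (n : ℕ) :
    (drivingLaw γ).map (fun ω => ω n) = (expMeasure 1).prod (expMeasure γ) := by
  have : IsProbabilityMeasure (expMeasure 1) := isProbabilityMeasure_expMeasure one_pos
  have : IsProbabilityMeasure (expMeasure γ) := isProbabilityMeasure_expMeasure hγ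
  exact Measure.infinitePi_map_eval _ n

theorem iIndepFun_drivingLaw {γ : ℝ} (hγ : 0 < γ) :
    iIndepFun (fun (n : ℕ) (ω : ℕ → ℝ × ℝ) => ω n) (drivingLaw γ) := by
  have : IsProbabilityMeasure (expMeasure 1) := isProbabilityMeasure_expMeasure one_pos
  have : IsProbabilityMeasure (expMeasure γ) := isProbabilityMeasure_expMeasure hγ
  exact iIndepFun_infinitePi (P := fun _ : ℕ => (expMeasure 1).prod (expMeasure γ))
    (X := fun _ x => x) (fun _ => measurable_id)

theorem ae_pos_drivingLaw {γ : ℝ} (hγ : 0 < γ) :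
    ∀ᵐ ω ∂drivingLaw γ, ∀ n, 0 < (ω n).1 ∧ 0 < (ω n).2 := by
  have : IsProbabilityMeasure (expMeasure 1) := isProbabilityMeasure_expMeasure one_pos
  have : IsProbabilityMeasure (expMeasure γ) := isProbabilityMeasure_expMeasure hγ
  rw [ae_all_iff]
  intro n
  have h1 : ∀ᵐ q ∂(expMeasure 1).prod (expMeasure γ), 0 < q.1 :=
    Measure.quasiMeasurePreserving_fst.ae (ae_pos_gammaMeasure 1 1)
  have h2 : ∀ᵐ q ∂(expMeasure 1).prod (expMeasure γ), 0 < q.2 :=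
    Measure.quasiMeasurePreserving_snd.ae (ae_pos_gammaMeasure 1 γ)
  have h := h1.and h2
  rw [← map_eval_drivingLaw hγ n] at h
  exact ae_of_ae_map (measurable_pi_apply n).aemeasurable h

/-- The state after n transitions uses only the coordinates below n, which are independent of the
n-th. The zero values in `ext` are never read. -/
theorem indepFun_chain {a β γ : ℝ} (ha : 0 < a) (hβ : 0 < β) (hγ : 0 < γ) (p : ℝ × ℝ) (n : ℕ) :
    IndepFun (fun ω => chain a β p ω n) (fun ω => ω n) (drivingLaw γ) := by
  have h := (iIndepFun_drivingLaw hγ).indepFun_finset (Finset.range n) {n} (by simp)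
    (fun i => measurable_pi_apply i)
  let ext : ((i : Finset.range n) → ℝ × ℝ) → ℕ → ℝ × ℝ := fun v i =>
    if hi : i ∈ Finset.range n then v ⟨i, hi⟩ else 0
  have hext : Measurable ext := by
    refine measurable_pi_lambda _ fun i => ?_
    by_cases hi : i ∈ Finset.range n
    · simp only [ext, hi, dif_pos]
      fun_prop
    · simp only [ext, hi, dif_neg, not_false_eq_true]
      fun_prop
  have hev : Measurable fun v : (i : ({n} : Finset ℕ)) → ℝ × ℝ => v ⟨n, by simp⟩ :=
    measurable_pi_apply _
  have h2 := h.comp (φ := fun v => chain a β p (ext v) n)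
    (ψ := fun v : (i : ({n} : Finset ℕ)) → ℝ × ℝ => v ⟨n, by simp⟩)
    ((measurable_chain ha hβ n).comp (measurable_const.prodMk hext)) hev
  refine h2.congr (ae_of_all _ fun ω => ?_) (ae_of_all _ fun ω => rfl)
  refine chain_congr fun i hi => ?_
  simp [ext, hi]

/-- The profile of the chain is a martingale; only the constancy of its mean is needed. -/
theorem integral_profile_chain {a β γ u : ℝ} {ψ : ℝ → ℝ} (ha : 0 < a) (hβ : 0 < β) (hγ : 0 < γ)
    (hβγ : 1 < β * γ) (hu : 0 < u) (hψ : IsRiccati β γ u ψ) {p : ℝ × ℝ} (hp : 0 ≤ p.2) (n : ℕ) :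
    ∫ ω, profile a β γ u ψ (chain a β p ω n) ∂drivingLaw γ = profile a β γ u ψ p := by
  have := isProbabilityMeasure_drivingLaw hγ
  have : IsProbabilityMeasure (expMeasure 1) := isProbabilityMeasure_expMeasure one_pos
  have : IsProbabilityMeasure (expMeasure γ) := isProbabilityMeasure_expMeasure hγ
  have hψc : Continuous ψ :=
    continuous_iff_continuousAt.mpr fun t => (hψ.hasDerivAt t).continuousAt
  have hmeas := measurable_profile hψc.measurable a β γ u
  have hchain : ∀ n, Measurable fun ω => chain a β p ω n := fun n =>
    (measurable_chain ha hβ n).comp (measurable_const.prodMk measurable_id)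
  induction n with
  | zero => simp [chain]
  | succ n ih =>
    -- Independence makes the joint law a product, so integrating out the new pair first reduces to
    -- the one-step identity.
    have hmap := (indepFun_chain ha hβ hγ p n).map_prod_eq_prod_map_map
      (hchain n).aemeasurable (measurable_pi_apply n).aemeasurable
    rw [map_eval_drivingLaw hγ n] at hmap
    have hF : Measurable fun z : (ℝ × ℝ) × (ℝ × ℝ) => profile a β γ u ψ (step a β z.1 z.2) :=
      hmeas.comp (measurable_step ha hβ)
    have hpos := ae_pos_drivingLaw hγ
    have : IsProbabilityMeasure ((drivingLaw γ).map fun ω => chain a β p ω n) :=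
      Measure.isProbabilityMeasure_map (hchain n).aemeasurable
    have e1 : ∫ ω, profile a β γ u ψ (chain a β p ω (n + 1)) ∂drivingLaw γ =
        ∫ z, profile a β γ u ψ (step a β z.1 z.2)
          ∂(drivingLaw γ).map fun ω => (chain a β p ω n, ω n) := by
      rw [integral_map ((hchain n).prodMk (measurable_pi_apply n)).aemeasurable
        hF.aestronglyMeasurable]
      rfl
    have hint : Integrable (fun z : (ℝ × ℝ) × (ℝ × ℝ) => profile a β γ u ψ (step a β z.1 z.2))
        ((drivingLaw γ).map fun ω => (chain a β p ω n, ω n)) := by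
      rw [integrable_map_measure hF.aestronglyMeasurable
        ((hchain n).prodMk (measurable_pi_apply n)).aemeasurable]
      refine Integrable.of_bound (hF.comp
        ((hchain n).prodMk (measurable_pi_apply n))).aestronglyMeasurable 1 ?_
      filter_upwards [hpos] with ω hω
      simp only [Function.comp]
      rw [norm_of_nonneg (profile_nonneg _ _ _ _ _ _)]
      exact profile_le_one ha hβ hβγ hu hψ (step_snd_nonneg
        (chain_snd_nonneg hp (fun i => (hω i).2.le) n) (hω n).2.le)
    rw [e1, hmap, integral_prod _ (hmap ▸ hint), ← ih,
      ← integral_map (hchain n).aemeasurable hmeas.aestronglyMeasurable]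
    refine integral_congr_ae ?_
    have hnn : ∀ᵐ s ∂(drivingLaw γ).map (fun ω => chain a β p ω n), 0 ≤ s.2 := by
      rw [ae_map_iff (hchain n).aemeasurable (measurableSet_le (by fun_prop) (by fun_prop))]
      filter_upwards [hpos] with ω hω
      exact chain_snd_nonneg hp (fun i => (hω i).2.le) n
    filter_upwards [hnn] with s hs
    exact integral_profile_step ha hβ hγ hβγ hu hψ hs

/-- Strong law of large numbers: the summands have mean β - 1/γ, positive precisely because βγ > 1.
-/
theorem ae_tendsto_sum_drivingLaw {β γ : ℝ} (hγ : 0 < γ) (hβγ : 1 < β * γ) :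
    ∀ᵐ ω ∂drivingLaw γ,
      Tendsto (fun n => ∑ i ∈ Finset.range n, (β * (ω i).1 - (ω i).2)) atTop atTop := by
  have := isProbabilityMeasure_drivingLaw hγ
  have : IsProbabilityMeasure (expMeasure 1) := isProbabilityMeasure_expMeasure one_pos
  have : IsProbabilityMeasure (expMeasure γ) := isProbabilityMeasure_expMeasure hγ
  let f : ℝ × ℝ → ℝ := fun q => β * q.1 - q.2
  have hf : Measurable f := by fun_prop
  have h1 : Integrable (fun q : ℝ × ℝ => β * q.1) ((expMeasure 1).prod (expMeasure γ)) :=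
    ((integrable_id_expMeasure one_pos).comp_fst _).const_mul β
  have h2 : Integrable (fun q : ℝ × ℝ => q.2) ((expMeasure 1).prod (expMeasure γ)) :=
    (integrable_id_expMeasure hγ).comp_snd _
  have hid : ∀ n, IdentDistrib (fun ω : ℕ → ℝ × ℝ => f (ω n)) (fun ω => f (ω 0))
      (drivingLaw γ) (drivingLaw γ) := by
    intro n
    have h : IdentDistrib (fun ω : ℕ → ℝ × ℝ => ω n) (fun ω => ω 0)
        (drivingLaw γ) (drivingLaw γ) :=
      ⟨(measurable_pi_apply n).aemeasurable, (measurable_pi_apply 0).aemeasurable,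
        (map_eval_drivingLaw hγ n).trans (map_eval_drivingLaw hγ 0).symm⟩
    exact h.comp hf
  have hint : Integrable (fun ω : ℕ → ℝ × ℝ => f (ω 0)) (drivingLaw γ) := by
    have : Integrable f ((expMeasure 1).prod (expMeasure γ)) := h1.sub h2
    rw [← map_eval_drivingLaw hγ 0, integrable_map_measure hf.aestronglyMeasurable
      (measurable_pi_apply 0).aemeasurable] at this
    exact this
  have hmean : ∫ ω, f (ω 0) ∂drivingLaw γ = β - 1 / γ := by
    have h0 : AEMeasurable (fun ω : ℕ → ℝ × ℝ => ω 0) (drivingLaw γ) :=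
      (measurable_pi_apply 0).aemeasurable
    rw [← integral_map (f := f) h0 hf.aestronglyMeasurable, map_eval_drivingLaw hγ,
      integral_sub h1 h2, integral_const_mul,
      integral_fun_fst (fun x : ℝ => x), integral_fun_snd (fun x : ℝ => x),
      integral_id_expMeasure one_pos, integral_id_expMeasure hγ]
    simp
  have hpos : 0 < β - 1 / γ := by
    rw [sub_pos, div_lt_iff₀ hγ]
    exact hβγ
  have hlln := strong_law_ae_real (fun n (ω : ℕ → ℝ × ℝ) => f (ω n)) hint
    (fun i j hij => ((iIndepFun_drivingLaw hγ).indepFun hij).comp hf hf) hid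
  rw [hmean] at hlln
  filter_upwards [hlln] with ω hω
  refine (hω.pos_mul_atTop hpos tendsto_natCast_atTop_atTop).congr' ?_
  filter_upwards [eventually_gt_atTop 0] with n hn
  have : (n : ℝ) ≠ 0 := by positivity
  rw [div_mul_cancel₀ _ this]

/-! ### Pathwise analysis and non-explosion. -/

/-- Event times and excess intensities right after the events. -/
noncomputable def jump (a β x : ℝ) (ω : ℕ → ℝ × ℝ) : ℕ → ℝ × ℝ
  | 0 => (0, x - a)
  | n + 1 =>
    ((jump a β x ω n).1 + hitTime a β (jump a β x ω n).2 (ω n).1,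
      (jump a β x ω n).2 * exp (-β * hitTime a β (jump a β x ω n).2 (ω n).1) + (ω n).2)

section Pathwise

variable {a β x : ℝ} {ω : ℕ → ℝ × ℝ}

theorem jump_snd_nonneg (hx : a ≤ x) (hω : ∀ i, 0 < (ω i).1 ∧ 0 < (ω i).2) (n : ℕ) :
    0 ≤ (jump a β x ω n).2 := by
  induction n with
  | zero => simpa [jump] using hx
  | succ n ih =>
    have := (hω n).2.le
    simp only [jump]
    positivity

theorem strictMono_jump_fst (ha : 0 < a) (hβ : 0 < β) (hω : ∀ i, 0 < (ω i).1 ∧ 0 < (ω i).2) :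
    StrictMono fun n => (jump a β x ω n).1 := by
  refine strictMono_nat_of_lt_succ fun n => ?_
  have := hitTime_pos ha hβ (hω n).1 (jump a β x ω n).2
  simp only [jump]
  linarith

/-- Balance between elapsed time, clock thresholds, shocks and excess intensity. -/
theorem jump_balance (ha : 0 < a) (hβ : 0 < β) (hx : a ≤ x)
    (hω : ∀ i, 0 < (ω i).1 ∧ 0 < (ω i).2) (n : ℕ) :
    β * a * (jump a β x ω n).1 =
      ∑ i ∈ Finset.range n, (β * (ω i).1 - (ω i).2) + (jump a β x ω n).2 - (x - a) := by
  induction n with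
  | zero => simp [jump]
  | succ n ih =>
    -- Multiplied by β, this says β e = β a τ + w(1 - exp(-βτ)): the threshold accounts for the
    -- elapsed time and for the decay of the excess.
    have h := cumHazard_hitTime ha hβ (hω n).1.le (jump a β x ω n).2
    rw [cumHazard, max_eq_left (jump_snd_nonneg hx hω n)] at h
    rw [Finset.sum_range_succ]
    simp only [jump]
    generalize hitTime a β (jump a β x ω n).2 (ω n).1 = τ at h ⊢
    rw [mul_add, ih, ← h]
    field_simp
    ring

theorem tendsto_jump_fst (ha : 0 < a) (hβ : 0 < β) (hx : a ≤ x)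
    (hω : ∀ i, 0 < (ω i).1 ∧ 0 < (ω i).2)
    (hsum : Tendsto (fun n => ∑ i ∈ Finset.range n, (β * (ω i).1 - (ω i).2)) atTop atTop) :
    Tendsto (fun n => (jump a β x ω n).1) atTop atTop := by
  have hba : 0 < β * a := by positivity
  refine (tendsto_const_mul_atTop_of_pos hba).mp ?_
  refine tendsto_atTop_mono (fun n => ?_) (tendsto_atTop_add_const_right _ (-(x - a)) hsum)
  rw [jump_balance ha hβ hx hω n]
  have := jump_snd_nonneg (β := β) hx hω n
  linarith

theorem integral_excess_eq_cumHazard (hβ : β ≠ 0) {w : ℝ} (hw : 0 ≤ w) (T t : ℝ) :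
    ∫ s in T..t, (a + w * exp (-β * (s - T))) = cumHazard a β w (t - T) := by
  have h := intervalIntegral.integral_eq_sub_of_hasDerivAt (a := T) (b := t)
    (f := fun s => cumHazard a β w (s - T)) (f' := fun s => a + w * exp (-β * (s - T)))
    (fun s _ => by
      have := (hasDerivAt_cumHazard hβ a w (s - T)).comp s ((hasDerivAt_id s).sub_const T)
      rw [max_eq_left hw, mul_one] at this
      exact this)
    (Continuous.intervalIntegrable (by fun_prop) _ _)
  rw [h]
  simp

/-- The exponential kernel is what makes the intensity Markovian: all past shocks decay at the same
rate, so they collapse into one excess attached to the last event. -/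
theorem stage_eq_jump (ha : 0 < a) (hβ : 0 < β) (hx : a ≤ x)
    (hω : ∀ i, 0 < (ω i).1 ∧ 0 < (ω i).2) (n : ℕ) :
    stage a β x (fun i => (ω i).1) (fun i => (ω i).2) n =
      ((jump a β x ω n).1,
        fun t => a + (jump a β x ω n).2 * exp (-β * (t - (jump a β x ω n).1))) := by
  induction n with
  | zero => simp [stage, jump]
  | succ n ih =>
    have hw := jump_snd_nonneg (β := β) hx hω n
    have hT : sInf {t : ℝ | (jump a β x ω n).1 ≤ t ∧ (ω n).1 ≤ ∫ s in (jump a β x ω n).1..t,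
        (a + (jump a β x ω n).2 * exp (-β * (s - (jump a β x ω n).1)))} =
        (jump a β x ω (n + 1)).1 := by
      refine IsLeast.csInf_eq ⟨⟨?_, ?_⟩, ?_⟩
      · exact (strictMono_jump_fst ha hβ hω).monotone (Nat.le_succ n)
      · rw [integral_excess_eq_cumHazard hβ.ne' hw]
        simp only [jump, add_sub_cancel_left]
        exact (hitTime_mem ha hβ _ _).2
      · rintro t ⟨h1, h2⟩
        rw [integral_excess_eq_cumHazard hβ.ne' hw,
          ← hitTime_le_iff ha hβ (sub_nonneg.mpr h1)] at h2
        simp only [jump]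
        linarith
    rw [stage]
    simp only [ih, hT]
    refine Prod.ext rfl (funext fun t => ?_)
    simp only [jump]
    rw [add_mul, add_assoc, mul_assoc, ← exp_add]
    ring_nf

theorem exists_jump_interval (ha : 0 < a) (hβ : 0 < β) (hx : a ≤ x)
    (hω : ∀ i, 0 < (ω i).1 ∧ 0 < (ω i).2)
    (hsum : Tendsto (fun n => ∑ i ∈ Finset.range n, (β * (ω i).1 - (ω i).2)) atTop atTop)
    {t : ℝ} (ht : 0 ≤ t) :
    ∃ k, (jump a β x ω k).1 ≤ t ∧ t < (jump a β x ω (k + 1)).1 := by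
  have hex : ∃ n, t < (jump a β x ω n).1 :=
    ((tendsto_jump_fst ha hβ hx hω hsum).eventually_gt_atTop t).exists
  classical
  obtain ⟨k, hk⟩ : ∃ k, Nat.find hex = k + 1 := by
    refine Nat.exists_eq_succ_of_ne_zero fun h0 => ?_
    have := Nat.find_spec hex
    rw [h0] at this
    simp only [jump] at this
    linarith
  refine ⟨k, not_lt.mp (Nat.find_min hex (by omega)), ?_⟩
  rw [← hk]
  exact Nat.find_spec hex

theorem intensity_eq_of_mem_jump_interval (ha : 0 < a) (hβ : 0 < β) (hx : a ≤ x)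
    (hω : ∀ i, 0 < (ω i).1 ∧ 0 < (ω i).2) {t : ℝ} {k : ℕ} (hk : (jump a β x ω k).1 ≤ t)
    (hk' : t < (jump a β x ω (k + 1)).1) :
    intensity a β x (fun i => (ω i).1) (fun i => (ω i).2) t =
      a + (jump a β x ω k).2 * exp (-β * (t - (jump a β x ω k).1)) := by
  have hmono := strictMono_jump_fst (x := x) ha hβ hω
  have hcount : count a β x (fun i => (ω i).1) (fun i => (ω i).2) t = k := by
    -- Index shift: arrival i is the first component of `jump` at i + 1, so the arrivals up to t are
    -- those with i < k.
    have hset : {i : ℕ | arrivalTime a β x (fun i => (ω i).1) (fun i => (ω i).2) i ≤ t} =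
        Finset.range k := by
      ext i
      simp only [arrivalTime, stage_eq_jump ha hβ hx hω, mem_ofPred_eq, Finset.coe_range, mem_Iio]
      constructor
      · intro h
        by_contra! hi
        have := hmono.monotone (Nat.succ_le_succ hi)
        simp only [Nat.succ_eq_add_one] at this
        linarith
      · intro h
        exact (hmono.monotone h).trans hk
    rw [count, hset, Set.ncard_coe_finset, Finset.card_range]
  rw [intensity, hcount, ← stage_snd, stage_eq_jump ha hβ hx hω]

theorem chain_eq_jump (ha : 0 < a) (hβ : 0 < β) (hω : ∀ i, 0 < (ω i).1 ∧ 0 < (ω i).2)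
    {t : ℝ} {n : ℕ} (hn : (jump a β x ω n).1 ≤ t) :
    chain a β (t, x - a) ω n = (t - (jump a β x ω n).1, (jump a β x ω n).2) := by
  induction n with
  | zero => simp [chain, jump]
  | succ n ih =>
    have hle := ((strictMono_jump_fst (x := x) ha hβ hω).monotone (Nat.le_succ n)).trans hn
    have hhit : hitTime a β (jump a β x ω n).2 (ω n).1 ≤ t - (jump a β x ω n).1 := by
      simp only [jump] at hn
      linarith
    have hR := sub_nonneg.mpr hle
    rw [chain, ih hle, step, if_neg (not_lt.mpr hR),
      if_pos ((hitTime_le_iff ha hβ hR _ _).mp hhit)]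
    simp only [jump]
    rw [sub_sub]

/-- The chain reaches the horizon after finitely many transitions, with the intensity at the
horizon. -/
theorem eventually_chain_eq (ha : 0 < a) (hβ : 0 < β) (hx : a ≤ x)
    (hω : ∀ i, 0 < (ω i).1 ∧ 0 < (ω i).2)
    (hsum : Tendsto (fun n => ∑ i ∈ Finset.range n, (β * (ω i).1 - (ω i).2)) atTop atTop)
    {t : ℝ} (ht : 0 ≤ t) :
    ∀ᶠ n in atTop, chain a β (t, x - a) ω n =
      (-1, intensity a β x (fun i => (ω i).1) (fun i => (ω i).2) t - a) := by
  obtain ⟨k, hk, hk'⟩ := exists_jump_interval ha hβ hx hω hsum ht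
  rw [intensity_eq_of_mem_jump_interval ha hβ hx hω hk hk', add_sub_cancel_left]
  -- Transition k + 1 overshoots the horizon and sets the marker -1; every later one leaves the
  -- state fixed.
  refine eventually_atTop.mpr ⟨k + 1, fun n hn => ?_⟩
  induction n, hn using Nat.le_induction with
  | base =>
    have hR := sub_nonneg.mpr hk
    have hnot : ¬ (ω k).1 ≤ cumHazard a β (jump a β x ω k).2 (t - (jump a β x ω k).1) := by
      rw [← hitTime_le_iff ha hβ hR]
      simp only [jump] at hk'
      linarith
    rw [chain, chain_eq_jump ha hβ hω hk, step, if_neg (not_lt.mpr hR), if_neg hnot]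
  | succ n hn ih =>
    rw [chain, ih, step, if_pos (by norm_num)]

end Pathwise

/-! ### Laplace transform of the transition law. -/

/-- A jointly measurable version of the excess intensity at time `t`, as a function of the initial
excess intensity and the driving sequence. -/
noncomputable def excess (a β t : ℝ) (z : ℝ × (ℕ → ℝ × ℝ)) : ℝ :=
  limsup (fun n => (chain a β (t, z.1) z.2 n).2) atTop

theorem measurable_excess {a β : ℝ} (ha : 0 < a) (hβ : 0 < β) (t : ℝ) :
    Measurable (excess a β t) := by
  refine Measurable.limsup fun n => ?_
  exact measurable_snd.comp ((measurable_chain ha hβ n).comp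
    (f := fun z : ℝ × (ℕ → ℝ × ℝ) => ((t, z.1), z.2)) (by fun_prop))

theorem ae_eventually_chain_eq {a β γ : ℝ} (ha : 0 < a) (hβ : 0 < β) (hγ : 0 < γ)
    (hβγ : 1 < β * γ) :
    ∀ᵐ ω ∂drivingLaw γ, (∀ i, 0 < (ω i).1 ∧ 0 < (ω i).2) ∧ ∀ x, a ≤ x → ∀ t, 0 ≤ t →
      ∀ᶠ n in atTop, chain a β (t, x - a) ω n =
        (-1, intensity a β x (fun i => (ω i).1) (fun i => (ω i).2) t - a) := by
  filter_upwards [ae_pos_drivingLaw hγ, ae_tendsto_sum_drivingLaw hγ hβγ] with ω hω hsum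
  exact ⟨hω, fun x hx t ht => eventually_chain_eq ha hβ hx hω hsum ht⟩

theorem excess_eq_of_eventually {a β t w v : ℝ} {ω : ℕ → ℝ × ℝ}
    (h : ∀ᶠ n in atTop, chain a β (t, w) ω n = (-1, v)) : excess a β t (w, ω) = v := by
  have : Tendsto (fun n => (chain a β (t, w) ω n).2) atTop (𝓝 v) :=
    tendsto_const_nhds.congr' (h.mono fun n hn => by simp only [hn])
  exact this.limsup_eq

theorem ae_excess {a β γ : ℝ} (ha : 0 < a) (hβ : 0 < β) (hγ : 0 < γ) (hβγ : 1 < β * γ)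
    {t x : ℝ} (ht : 0 ≤ t) (hx : a ≤ x) :
    ∀ᵐ ω ∂drivingLaw γ, 0 ≤ excess a β t (x - a, ω) ∧
      intensity a β x (fun i => (ω i).1) (fun i => (ω i).2) t = a + excess a β t (x - a, ω) ∧
      ∀ᶠ n in atTop, chain a β (t, x - a) ω n = (-1, excess a β t (x - a, ω)) := by
  filter_upwards [ae_eventually_chain_eq ha hβ hγ hβγ] with ω hω
  have h := hω.2 x hx t ht
  have he := excess_eq_of_eventually h
  rw [he]
  refine ⟨?_, by ring, h⟩
  obtain ⟨n, hn⟩ := h.exists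
  have := chain_snd_nonneg (a := a) (β := β) (p := (t, x - a)) (sub_nonneg.mpr hx)
    (fun i => (hω.1 i).2.le) n
  rwa [hn] at this

/-- Almost sure agreement with the measurable `excess` suffices; measurability of `intensity` itself
is never proved separately. -/
theorem transitionLaw_eq_map {a β γ : ℝ} (ha : 0 < a) (hβ : 0 < β) (hγ : 0 < γ)
    (hβγ : 1 < β * γ) {t x : ℝ} (ht : 0 ≤ t) (hx : a ≤ x) :
    transitionLaw a β γ t x =
      (drivingLaw γ).map fun ω => a + excess a β t (x - a, ω) :=
  Measure.map_congr ((ae_excess ha hβ hγ hβγ ht hx).mono fun _ h => h.2.1)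

/-- Laplace transform of the excess intensity at time `t`. -/
theorem integral_exp_neg_mul_excess {a β γ u : ℝ} {ψ : ℝ → ℝ} (ha : 0 < a) (hβ : 0 < β)
    (hγ : 0 < γ) (hβγ : 1 < β * γ) (hu : 0 < u) (hψ : IsRiccati β γ u ψ) {t x : ℝ} (ht : 0 ≤ t)
    (hx : a ≤ x) :
    ∫ ω, exp (-u * excess a β t (x - a, ω)) ∂drivingLaw γ =
      exp (-(x - a) * ψ t + logFactor a β γ (ψ t) - logFactor a β γ u) := by
  have := isProbabilityMeasure_drivingLaw hγ
  have hψc : Continuous ψ :=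
    continuous_iff_continuousAt.mpr fun t => (hψ.hasDerivAt t).continuousAt
  have hp : (0 : ℝ) ≤ (t, x - a).2 := sub_nonneg.mpr hx
  -- Once the chain is frozen, its profile equals exp(-u * excess); the means converge by domination
  -- although they do not depend on n.
  have hlim : Tendsto (fun n => ∫ ω, profile a β γ u ψ (chain a β (t, x - a) ω n) ∂drivingLaw γ)
      atTop (𝓝 (∫ ω, exp (-u * excess a β t (x - a, ω)) ∂drivingLaw γ)) := by
    refine tendsto_integral_of_dominated_convergence (fun _ => 1) (fun n => ?_)
      (integrable_const 1) (fun n => ?_) ?_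
    · exact ((measurable_profile hψc.measurable a β γ u).comp ((measurable_chain ha hβ n).comp
        (measurable_const.prodMk measurable_id))).aestronglyMeasurable
    · filter_upwards [ae_pos_drivingLaw hγ] with ω hω
      rw [norm_of_nonneg (profile_nonneg _ _ _ _ _ _)]
      exact profile_le_one ha hβ hβγ hu hψ (chain_snd_nonneg hp (fun i => (hω i).2.le) n)
    · filter_upwards [ae_excess ha hβ hγ hβγ ht hx] with ω hω
      refine tendsto_const_nhds.congr' (hω.2.2.mono fun n hn => ?_)
      simp [hn, profile]
  have hconst : ∀ n, ∫ ω, profile a β γ u ψ (chain a β (t, x - a) ω n) ∂drivingLaw γ =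
      exp (-(x - a) * ψ t + logFactor a β γ (ψ t) - logFactor a β γ u) := by
    intro n
    rw [integral_profile_chain ha hβ hγ hβγ hu hψ hp n, profile, if_neg (not_lt.mpr ht)]
  simp_rw [hconst] at hlim
  exact tendsto_nhds_unique hlim tendsto_const_nhds

/-- Law of the excess intensity at time `t` when the excess intensity has initial law `ρ`. -/
noncomputable def excessLaw (a β γ t : ℝ) (ρ : Measure ℝ) : Measure ℝ :=
  (ρ.prod (drivingLaw γ)).map (excess a β t)

theorem isProbabilityMeasure_excessLaw {a β γ : ℝ} (ha : 0 < a) (hβ : 0 < β) (hγ : 0 < γ) (t : ℝ)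
    (ρ : Measure ℝ) [IsProbabilityMeasure ρ] : IsProbabilityMeasure (excessLaw a β γ t ρ) := by
  have := isProbabilityMeasure_drivingLaw hγ
  exact Measure.isProbabilityMeasure_map (measurable_excess ha hβ t).aemeasurable

theorem ae_nonneg_excessLaw {a β γ : ℝ} (ha : 0 < a) (hβ : 0 < β) (hγ : 0 < γ) (hβγ : 1 < β * γ)
    {t : ℝ} (ht : 0 ≤ t) (ρ : Measure ℝ) [IsProbabilityMeasure ρ] (hρ : ∀ᵐ w ∂ρ, 0 ≤ w) :
    ∀ᵐ w ∂excessLaw a β γ t ρ, 0 ≤ w := by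
  have := isProbabilityMeasure_drivingLaw hγ
  have hm := measurable_excess ha hβ t
  rw [excessLaw, ae_map_iff hm.aemeasurable measurableSet_Ici]
  refine (Measure.ae_prod_iff_ae_ae (hm measurableSet_Ici)).mpr ?_
  filter_upwards [hρ] with w hw
  have h := ae_excess ha hβ hγ hβγ ht (x := w + a) (by linarith)
  rw [add_sub_cancel_right] at h
  exact h.mono fun _ h => h.1

theorem integral_exp_neg_mul_excessLaw {a β γ u : ℝ} {ψ : ℝ → ℝ} (ha : 0 < a) (hβ : 0 < β)
    (hγ : 0 < γ) (hβγ : 1 < β * γ) (hu : 0 < u) (hψ : IsRiccati β γ u ψ) {t : ℝ} (ht : 0 ≤ t)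
    (ρ : Measure ℝ) [IsProbabilityMeasure ρ] (hρ : ∀ᵐ w ∂ρ, 0 ≤ w) :
    ∫ w, exp (-u * w) ∂excessLaw a β γ t ρ =
      exp (logFactor a β γ (ψ t) - logFactor a β γ u) * ∫ w, exp (-ψ t * w) ∂ρ := by
  have := isProbabilityMeasure_drivingLaw hγ
  have hm := measurable_excess ha hβ t
  have hf : Measurable fun w : ℝ => exp (-u * w) := by fun_prop
  have hint : Integrable (fun z => exp (-u * excess a β t z)) (ρ.prod (drivingLaw γ)) := by
    refine Integrable.of_bound (hf.comp hm).aestronglyMeasurable 1 ?_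
    filter_upwards [ae_of_ae_map hm.aemeasurable (ae_nonneg_excessLaw ha hβ hγ hβγ ht ρ hρ)]
      with z hz
    rw [norm_of_nonneg (exp_pos _).le]
    exact exp_le_one_iff.mpr (by nlinarith)
  rw [excessLaw, integral_map hm.aemeasurable hf.aestronglyMeasurable, integral_prod _ hint,
    ← integral_const_mul]
  refine integral_congr_ae ?_
  filter_upwards [hρ] with w hw
  have h := integral_exp_neg_mul_excess ha hβ hγ hβγ hu hψ ht (x := w + a) (by linarith)
  rw [add_sub_cancel_right] at h
  rw [h, ← exp_add]
  ring_nf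

/-- Tonelli, made possible by the joint measurability of `excess` in the starting point and the
driving sequence. -/
theorem lintegral_transitionLaw {a β γ : ℝ} (ha : 0 < a) (hβ : 0 < β) (hγ : 0 < γ)
    (hβγ : 1 < β * γ) {t : ℝ} (ht : 0 ≤ t) (ρ : Measure ℝ) [IsProbabilityMeasure ρ]
    (hρ : ∀ᵐ w ∂ρ, 0 ≤ w) {B : Set ℝ} (hB : MeasurableSet B) :
    ∫⁻ x, transitionLaw a β γ t x B ∂ρ.map (fun z => a + z) =
      (excessLaw a β γ t ρ).map (fun z => a + z) B := by
  have := isProbabilityMeasure_drivingLaw hγ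
  have hm := measurable_excess ha hβ t
  have hadd : Measurable fun z : ℝ => a + z := by fun_prop
  have hemb : MeasurableEmbedding fun z : ℝ => a + z := measurableEmbedding_addLeft a
  rw [hemb.lintegral_map, excessLaw, Measure.map_map hadd hm,
    Measure.map_apply (hadd.comp hm) hB, Measure.prod_apply ((hadd.comp hm) hB)]
  refine lintegral_congr_ae ?_
  filter_upwards [hρ] with w hw
  rw [transitionLaw_eq_map ha hβ hγ hβγ ht (by linarith), add_sub_cancel_left]
  exact Measure.map_apply (hadd.comp (hm.comp (measurable_const.prodMk measurable_id))) hB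

/-! ### Invariance and uniqueness of the Gamma law. -/

/-- Stationarity expressed for the excess intensity. -/
theorem isStationaryLaw_map_iff {a β γ : ℝ} (ha : 0 < a) (hβ : 0 < β) (hγ : 0 < γ)
    (hβγ : 1 < β * γ) (ρ : Measure ℝ) [IsProbabilityMeasure ρ] (hρ : ∀ᵐ w ∂ρ, 0 ≤ w) :
    IsStationaryLaw a β γ (ρ.map fun z => a + z) ↔ ∀ t, 0 ≤ t → excessLaw a β γ t ρ = ρ := by
  have hadd : Measurable fun z : ℝ => a + z := by fun_prop
  have hemb : MeasurableEmbedding fun z : ℝ => a + z := measurableEmbedding_addLeft a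
  constructor
  · intro h t ht
    have h' : (excessLaw a β γ t ρ).map (fun z => a + z) = ρ.map fun z => a + z := by
      ext B hB
      rw [← lintegral_transitionLaw ha hβ hγ hβγ ht ρ hρ hB, h.invariant t ht B hB]
    have := congrArg (Measure.comap fun z : ℝ => a + z) h'
    rwa [hemb.comap_map, hemb.comap_map] at this
  · intro h
    refine ⟨Measure.isProbabilityMeasure_map hadd.aemeasurable, ?_, fun t ht B hB => ?_⟩
    · rw [Measure.map_apply hadd measurableSet_Iio]
      refine measure_mono_null (fun z hz => ?_) (ae_iff.mp hρ)
      simp only [mem_preimage, mem_Iio] at hz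
      simp only [not_le, mem_ofPred_eq]
      linarith
    · rw [lintegral_transitionLaw ha hβ hγ hβγ ht ρ hρ hB, h t ht]

theorem exp_logFactor_sub {a β γ u : ℝ} (hβ : 0 < β) (hβγ : 1 < β * γ) (hu : 0 ≤ u) :
    exp (logFactor a β γ 0 - logFactor a β γ u) =
      ((β * γ - 1) / β / ((β * γ - 1) / β + u)) ^ (a / β) := by
  have hc : 0 < β * γ - 1 := by linarith
  have e : (β * γ - 1) / β / ((β * γ - 1) / β + u) = (β * γ - 1) / (β * γ - 1 + β * u) := by
    field_simp
  rw [e, rpow_def_of_pos (by positivity), log_div hc.ne' (by positivity)]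
  unfold logFactor
  rw [mul_zero, add_zero]
  ring_nf

theorem integral_exp_neg_mul_gammaMeasure_eq {a β γ u : ℝ} (ha : 0 < a) (hβ : 0 < β)
    (hβγ : 1 < β * γ) (hu : 0 ≤ u) :
    ∫ w, exp (-u * w) ∂gammaMeasure (a / β) ((β * γ - 1) / β) =
      exp (logFactor a β γ 0 - logFactor a β γ u) := by
  have hc : 0 < β * γ - 1 := by linarith
  rw [exp_logFactor_sub hβ hβγ hu, integral_exp_neg_mul_gammaMeasure (by positivity)
    (by positivity) hu]

/-- Telescoping: exp(L(ψ(t)) - L(u)) times exp(L(0) - L(ψ(t))) is exp(L(0) - L(u)), with L =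
`logFactor`. -/
theorem excessLaw_gammaMeasure {a β γ : ℝ} (ha : 0 < a) (hβ : 0 < β) (hγ : 0 < γ)
    (hβγ : 1 < β * γ) {t : ℝ} (ht : 0 ≤ t) :
    excessLaw a β γ t (gammaMeasure (a / β) ((β * γ - 1) / β)) =
      gammaMeasure (a / β) ((β * γ - 1) / β) := by
  have hc : 0 < β * γ - 1 := by linarith
  set ρ := gammaMeasure (a / β) ((β * γ - 1) / β)
  have : IsProbabilityMeasure ρ :=
    isProbabilityMeasure_gammaMeasure (by positivity) (by positivity)
  have hρ : ∀ᵐ w ∂ρ, 0 ≤ w := (ae_pos_gammaMeasure _ _).mono fun _ h => h.le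
  have := isProbabilityMeasure_excessLaw ha hβ hγ t ρ
  refine ext_of_integral_exp_neg_mul (ae_nonneg_excessLaw ha hβ hγ hβγ ht ρ hρ) hρ fun u hu => ?_
  obtain ⟨ψ, h0, h1, h2, h3, h4⟩ := exists_riccati hβ hγ hβγ hu
  rw [integral_exp_neg_mul_excessLaw ha hβ hγ hβγ hu ⟨h0, h1, h2, h3, h4⟩ ht ρ hρ,
    integral_exp_neg_mul_gammaMeasure_eq ha hβ hβγ (h1 t).le,
    integral_exp_neg_mul_gammaMeasure_eq ha hβ hβγ hu.le, ← exp_add]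
  ring_nf

theorem eq_gammaMeasure_of_excessLaw_eq {a β γ : ℝ} (ha : 0 < a) (hβ : 0 < β) (hγ : 0 < γ)
    (hβγ : 1 < β * γ) (ρ : Measure ℝ) [IsProbabilityMeasure ρ] (hρ : ∀ᵐ w ∂ρ, 0 ≤ w)
    (h : ∀ t, 0 ≤ t → excessLaw a β γ t ρ = ρ) :
    ρ = gammaMeasure (a / β) ((β * γ - 1) / β) := by
  have hc : 0 < β * γ - 1 := by linarith
  have : IsProbabilityMeasure (gammaMeasure (a / β) ((β * γ - 1) / β)) :=
    isProbabilityMeasure_gammaMeasure (by positivity) (by positivity)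
  refine ext_of_integral_exp_neg_mul hρ ((ae_pos_gammaMeasure _ _).mono fun _ h => h.le)
    fun u hu => ?_
  obtain ⟨ψ, h0, h1, h2, h3, h4⟩ := exists_riccati hβ hγ hβγ hu
  rw [integral_exp_neg_mul_gammaMeasure_eq ha hβ hβγ hu.le]
  have hlim : Tendsto (fun t => exp (logFactor a β γ (ψ t) - logFactor a β γ u) *
      ∫ w, exp (-ψ t * w) ∂ρ) atTop
      (𝓝 (exp (logFactor a β γ 0 - logFactor a β γ u) * ∫ w, exp (-0 * w) ∂ρ)) := by
    refine Tendsto.mul ?_ ?_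
    · have hcont : ContinuousAt
          (fun v => exp (logFactor a β γ v - logFactor a β γ u)) 0 := by
        unfold logFactor
        have : β * γ - 1 + β * 0 ≠ 0 := by simpa using hc.ne'
        fun_prop (disch := assumption)
      exact hcont.tendsto.comp h4
    · refine tendsto_integral_filter_of_dominated_convergence (fun _ => 1)
        (Eventually.of_forall fun t => by fun_prop) (Eventually.of_forall fun t => ?_)
        (integrable_const 1) (ae_of_all _ fun w => ?_)
      · filter_upwards [hρ] with w hw
        rw [norm_of_nonneg (exp_pos _).le]
        exact exp_le_one_iff.mpr (by nlinarith [h1 t])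
      · exact (continuous_exp.tendsto _).comp (h4.neg.mul_const w)
  -- By invariance the expression is constant in t ≥ 0, so it equals its limit, in which the initial
  -- law survives only through its total mass 1.
  have hev : ∀ᶠ t in atTop, exp (logFactor a β γ (ψ t) - logFactor a β γ u) *
      ∫ w, exp (-ψ t * w) ∂ρ = ∫ w, exp (-u * w) ∂ρ := by
    filter_upwards [eventually_ge_atTop 0] with t ht
    rw [← integral_exp_neg_mul_excessLaw ha hβ hγ hβγ hu ⟨h0, h1, h2, h3, h4⟩ ht ρ hρ, h t ht]
  have hlim' := tendsto_nhds_unique (tendsto_const_nhds.congr' (hev.mono fun _ h => h.symm)) hlim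
  simpa using hlim'

end MarkovHawkes

open MarkovHawkes in
theorem mainTheorem9 (a β γ : ℝ) (ha : 0 < a) (hβ : 0 < β) (hγ : 0 < γ) (hβγ : 1 < β * γ) :
    MarkovHawkes.IsStationaryLaw a β γ
        ((gammaMeasure (a / β) ((β * γ - 1) / β)).map (fun z : ℝ => a + z)) ∧
      ∀ ν : Measure ℝ, MarkovHawkes.IsStationaryLaw a β γ ν →
        ν = (gammaMeasure (a / β) ((β * γ - 1) / β)).map (fun z : ℝ => a + z) := by
  have hc : 0 < β * γ - 1 := by linarith
  have : IsProbabilityMeasure (gammaMeasure (a / β) ((β * γ - 1) / β)) :=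
    isProbabilityMeasure_gammaMeasure (by positivity) (by positivity)
  refine ⟨(isStationaryLaw_map_iff ha hβ hγ hβγ _
    ((ae_pos_gammaMeasure _ _).mono fun _ h => h.le)).mpr fun t ht =>
      excessLaw_gammaMeasure ha hβ hγ hβγ ht, fun ν hν => ?_⟩
  have := hν.isProbabilityMeasure
  have hsub : Measurable fun x : ℝ => x - a := by fun_prop
  have hadd : Measurable fun z : ℝ => a + z := by fun_prop
  -- Translation by -a passes to the excess; the support condition on ν becomes its nonnegativity.
  have hprob : IsProbabilityMeasure (ν.map fun x => x - a) :=
    Measure.isProbabilityMeasure_map hsub.aemeasurable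
  have hmap : (ν.map fun x => x - a).map (fun z => a + z) = ν := by
    rw [Measure.map_map hadd hsub]
    convert Measure.map_id using 2
    ext x
    simp
  have hnonneg : ∀ᵐ w ∂ν.map fun x => x - a, 0 ≤ w := by
    rw [ae_map_iff hsub.aemeasurable measurableSet_Ici, ae_iff]
    convert hν.support using 2
    ext x
    simp
  have hstat : IsStationaryLaw a β γ ((ν.map fun x => x - a).map fun z => a + z) := by
    rwa [hmap]
  rw [← eq_gammaMeasure_of_excessLaw_eq ha hβ hγ hβγ _ hnonneg
    ((isStationaryLaw_map_iff ha hβ hγ hβγ _ hnonneg).mp hstat), hmap]
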